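/- **Setting.** A configuration on $\mathbb{R}$ is a Radon (locally finite Borel) measure $\xi$ on $\mathbb{R}$ with values in $\{0,1,2,\dots\}\cup\{\infty\}$; $\mathrm{Conf}(\mathbb{R})$ is the space of configurations with the Borel $\sigma$-algebra of the vague topology. A point process is a Borel probability measure $\mathbb{P}$ on $\mathrm{Conf}(\mathbb{R})$; it is simple if almost every $\xi$ satisfies $\xi(\{x\})\in\{0,1\}$ for all $x\in\mathbb{R}$. A $k$-point correlation function of a simple point process $\mathbb{P}$ is a non-negative locally integrable function $\rho^{(k)}:\mathbb{R}^k\to\mathbb{R}$ such that for every continuous compactly supported $\varphi:\mathbb{R}^k\to\mathbb{C}$ the function $\xi\mapsto\sum^*_{x_1,\dots,x_k\in\xi}\varphi(x_1,\dots,x_k)$ is $\mathbb{P}$-integrable and $$\int \sum^*_{x_1,\dots,x_k\in\xi}\varphi(x_1,\dots,x_k)\,\mathbb{P}(d\xi)=\int_{\mathbb{R}^k}\varphi(x_1,\dots,x_k)\,\rho^{(k)}(x_1,\dots,x_k)\,dx_1\cdots dx_k,$$ where $\sum^*$ is the sum over ordered $k$-tuples of pairwise distinct points of $\xi$. Let $S(x)=\frac{\sin(\pi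 x)}{\pi x}$ (with $S(0)=1$), $IS(x)=\int_0^x S(t)\,dt$, $\varepsilon(x)=\frac12\operatorname{sgn}(x)$ (with $\varepsilon(0)=0$), $J=\begin{bmatrix}0&1\\-1&0\end{bmatrix}$ and $$K(x,y)=\begin{bmatrix} S(x-y) & IS(x-y)-\varepsilon(x-y)\\ S'(x-y) & S(x-y)\end{bmatrix}.$$ The orthogonal sine process ($\mathrm{Sine}_1$-process) is the Pfaffian point process with matrix kernel $K$, that is, the simple point process $\mathbb{P}$ on $\mathbb{R}$ which for every $k\ge1$ has the $k$-point correlation function $$\rho^{(k)}(x_1,\dots,x_k)=\mathrm{Pf}\,[K(x_i,x_j)J]_{1\le i,j\le k}.$$ **Proposition 1.5.** The orthogonal sine process $\mathbb{P}$ is number rigid: for every bounded Borel set $B\subset\mathbb{R}$ there is a Borel function $F_B:\mathrm{Conf}(\mathbb{R})\to\mathbb{Z}$ such that $$\xi(B)=F_B\big(\xi|_{\mathbb{R}\setminus B}\big)\quad\text{for }\mathbb{P}\text{-almost every }\xi\in\mathrm{Conf}(\mathbb{R}).$$ -/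

import Mathlib

open MeasureTheory
open scoped CompactlySupported

namespace PfaffianPP

/-- The space `Conf(ℝ)` of locally finite configurations: Radon measures on the real line taking
values in `{0, 1, 2, …} ∪ {∞}`. (On `ℝ` the Radon measures are the locally finite Borel
measures; they are finite on bounded sets.) -/
structure Conf where
  toMeasure : Measure ℝ
  locallyFinite : IsLocallyFiniteMeasure toMeasure
  integerValued : ∀ s : Set ℝ, MeasurableSet s → ∃ n : ℕ∞, toMeasure s = (n : ENNReal)

/-- The vague topology, generated by the maps `ξ ↦ ∫ f dξ` for continuous compactly supported
`f : ℝ → ℂ`. -/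
noncomputable instance : TopologicalSpace Conf :=
  ⨅ f : C_c(ℝ, ℂ), TopologicalSpace.induced (fun ξ : Conf => ∫ x, f x ∂ξ.toMeasure) inferInstance

/-- The Borel σ-algebra of the vague topology. -/
noncomputable instance : MeasurableSpace Conf := borel Conf

instance : BorelSpace Conf := ⟨rfl⟩

/-- The restriction `ξ|_S` of a configuration to a Borel set `S`. -/
noncomputable def Conf.restrict (ξ : Conf) (S : Set ℝ) (hS : MeasurableSet S) : Conf where
  toMeasure := ξ.toMeasure.restrict S
  locallyFinite :=
    haveI := ξ.locallyFinite
    inferInstance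
  integerValued := fun t ht => by
    rw [Measure.restrict_apply ht]
    exact ξ.integerValued _ (ht.inter hS)

/-- A configuration is simple if each point has mass `0` or `1`. -/
def Conf.IsSimple (ξ : Conf) : Prop :=
  ∀ x : ℝ, ξ.toMeasure {x} = 0 ∨ ξ.toMeasure {x} = 1

/-- A point process (a Borel probability measure on `Conf`) is simple if almost every
configuration is. -/
def IsSimpleProcess (P : Measure Conf) : Prop :=
  ∀ᵐ ξ ∂P, ξ.IsSimple

/-- Number rigidity: for each bounded Borel set `B` there is a Borel function
`F : Conf(ℝ) → ℤ` with `ξ(B) = F (ξ|_{ℝ ∖ B})` for `P`-almost every `ξ`.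
Since `B` is bounded, `ξ(B)` is finite, and it is read here as a real number. -/
def NumberRigid (P : Measure Conf) : Prop :=
  ∀ (B : Set ℝ) (hB : MeasurableSet B), Bornology.IsBounded B →
    ∃ F : Conf → ℤ, Measurable F ∧
      ∀ᵐ ξ ∂P, ξ.toMeasure.real B = (F (ξ.restrict Bᶜ hB.compl) : ℝ)

/-- The ordered `k`-tuples of pairwise distinct points of a configuration. -/
def Conf.distinctTuples (ξ : Conf) (k : ℕ) : Set (Fin k → ℝ) :=
  {x | Function.Injective x ∧ ∀ i, ξ.toMeasure {x i} ≠ 0}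

/-- The sum of `φ (x₁, …, x_k)` over the ordered `k`-tuples of pairwise distinct points of `ξ`.
Only finitely many terms are nonzero, because `φ` has compact support. -/
noncomputable def Conf.distinctSum (ξ : Conf) {k : ℕ} (φ : C_c(Fin k → ℝ, ℂ)) : ℂ :=
  ∑' x : ξ.distinctTuples k, φ (x : Fin k → ℝ)

/-- `ρ` is a `k`-point correlation function of the (simple) point process `P` with respect to
Lebesgue measure. The integrability clauses say that both sides of the defining identity are
meaningful. -/
structure IsCorrelationFunction (P : Measure Conf) (k : ℕ) (ρ : (Fin k → ℝ) → ℝ) : Prop where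
  nonneg : ∀ x, 0 ≤ ρ x
  locallyIntegrable : LocallyIntegrable ρ volume
  integrable : ∀ φ : C_c(Fin k → ℝ, ℂ), Integrable (fun ξ : Conf => ξ.distinctSum φ) P
  integral_eq : ∀ φ : C_c(Fin k → ℝ, ℂ),
    ∫ ξ, ξ.distinctSum φ ∂P = ∫ x, φ x * (ρ x : ℂ)

/-- The Pfaffian of a `2k × 2k` antisymmetric matrix `A`,
`(1 / (2^k k!)) ∑_σ sgn(σ) ∏_i A_{σ(2i-1), σ(2i)}`, the index `2i - 1` being written `(i, 0)` and
the index `2i` being written `(i, 1)`. -/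
noncomputable def pfaffian {k : ℕ} (A : Matrix (Fin k × Fin 2) (Fin k × Fin 2) ℂ) : ℂ :=
  (1 / (2 ^ k * (Nat.factorial k : ℂ))) *
    ∑ σ : Equiv.Perm (Fin k × Fin 2),
      ((Equiv.Perm.sign σ : ℤ) : ℂ) * ∏ i : Fin k, A (σ (i, 0)) (σ (i, 1))

/-- The matrix `J = [[0, 1], [-1, 0]]`. -/
def matJ : Matrix (Fin 2) (Fin 2) ℂ := !![0, 1; -1, 0]

/-- The `2k × 2k` matrix with `2 × 2` blocks `K(x_i, x_j) J`. -/
def blockMatrix (K : ℝ → ℝ → Matrix (Fin 2) (Fin 2) ℂ) {k : ℕ} (x : Fin k → ℝ) :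
    Matrix (Fin k × Fin 2) (Fin k × Fin 2) ℂ :=
  Matrix.of fun p q => (K (x p.1) (x q.1) * matJ) p.2 q.2

/-- `P` is a Pfaffian point process induced by the matrix kernel `K`. -/
structure IsPfaffianProcess (P : Measure Conf) (K : ℝ → ℝ → Matrix (Fin 2) (Fin 2) ℂ) :
    Prop where
  isProbability : IsProbabilityMeasure P
  simple : IsSimpleProcess P
  antisymm : ∀ x y, (K x y * matJ).transpose = -(K y x * matJ)
  correlation : ∀ k : ℕ, 0 < k → ∃ ρ : (Fin k → ℝ) → ℝ, IsCorrelationFunction P k ρ ∧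
    ∀ x, (ρ x : ℂ) = pfaffian (blockMatrix K x)

/-- `S(x) = sin(πx) / (πx)`, with `S(0) = 1`. -/
noncomputable def sineS (x : ℝ) : ℝ := Real.sinc (Real.pi * x)

/-- `IS(x) = ∫₀ˣ S(t) dt`. -/
noncomputable def sineIS (x : ℝ) : ℝ := ∫ t in (0 : ℝ)..x, sineS t

/-- `ε(x) = sgn(x) / 2`, with `ε(0) = 0`. -/
noncomputable def halfSign (x : ℝ) : ℝ := 1 / 2 * Real.sign x

/-- The matrix kernel of the orthogonal sine process. -/
noncomputable def sineKernelOne (x y : ℝ) : Matrix (Fin 2) (Fin 2) ℂ :=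
  !![(sineS (x - y) : ℂ), ((sineIS (x - y) - halfSign (x - y) : ℝ) : ℂ);
     ((deriv sineS (x - y) : ℝ) : ℂ), (sineS (x - y) : ℂ)]

end PfaffianPP

open scoped CompactlySupported

namespace PfaffianPP

open MeasureTheory Set Filter Topology

/-! Rigidity follows from linear statistics that equal `1` on `B` and have vanishing variance: if
the centred statistic tends to `0`, its part outside `B` tends to `-ξ(B)`.

The Pfaffians of order one and two give intensity `1` and pair correlation `1 - T(x - y)`, with `T =
truncCorr` even and `O(1 / (1 + r²))`. The sum rule `∫ T = 1` (`integral_truncCorr`) cancels the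
diagonal term of the variance, so the covariance of the statistics of `f` and `g` is `∫ f · corrDiff
g`, where `corrDiff` averages second differences against `T` (`integral_centredStat_mul`). For a
bump `g` of scale `m`, `corrDiff g = O(1/m)`; hence bumps of scales `l` and `m` have covariance at
most `C l / m`.

A single dilated bump thus has bounded variance, which need not tend to `0`. Dyadic scales
decorrelate geometrically, so the mean of `n` dyadic bumps has variance `O(1/n)`
(`integral_sum_centredStat_sq_le`) and tends to `0` almost surely along a subsequence. -/

/-! ### The Dirichlet integral -/

lemma integral_Ioi_exp_neg_mul {x : ℝ} (hx : 0 < x) :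
    ∫ s in Ioi (0 : ℝ), Real.exp (-(s * x)) = 1 / x := by
  have h := integral_exp_mul_Ioi (neg_lt_zero.2 hx) 0
  simp only [mul_zero, Real.exp_zero, neg_div_neg_eq] at h
  rw [← h]
  exact integral_congr_ae (ae_of_all _ fun s => by ring_nf)

lemma integrableOn_Ioi_exp_neg_mul {x : ℝ} (hx : 0 < x) :
    IntegrableOn (fun s => Real.exp (-(s * x))) (Ioi (0 : ℝ)) := by
  refine (integrableOn_exp_mul_Ioi (neg_lt_zero.2 hx) 0).congr (ae_of_all _ fun s => ?_)
  ring_nf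

lemma integral_exp_neg_mul_sin (s R : ℝ) :
    ∫ x in (0 : ℝ)..R, Real.exp (-(s * x)) * Real.sin x =
      (1 - Real.exp (-(s * R)) * (Real.cos R + s * Real.sin R)) / (1 + s ^ 2) := by
  have hs : (1 + s ^ 2) ≠ 0 := by positivity
  have h : ∀ x ∈ uIcc 0 R, HasDerivAt
      (fun x => -(Real.exp (-(s * x)) * (Real.cos x + s * Real.sin x)) / (1 + s ^ 2))
      (Real.exp (-(s * x)) * Real.sin x) x := by
    intro x _
    have h1 : HasDerivAt (fun x => Real.exp (-(s * x))) (Real.exp (-(s * x)) * -s) x := by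
      simpa using (((hasDerivAt_id x).const_mul s).neg).exp
    have h2 : HasDerivAt (fun x => Real.cos x + s * Real.sin x)
        (-Real.sin x + s * Real.cos x) x :=
      (Real.hasDerivAt_cos x).add ((Real.hasDerivAt_sin x).const_mul s)
    refine ((h1.mul h2).neg.div_const _).congr_deriv ?_
    field_simp
    ring
  rw [intervalIntegral.integral_eq_sub_of_hasDerivAt h
    ((by fun_prop : Continuous _).intervalIntegrable _ _)]
  simp
  ring

/-- Integrating the norm in `s` leaves `|sin x| / x ≤ 1`, which is integrable on a bounded interval;
this licenses Fubini before `R → ∞`. -/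
lemma integrable_exp_neg_mul_sin_prod (R : ℝ) :
    Integrable (fun p : ℝ × ℝ => Real.exp (-(p.2 * p.1)) * Real.sin p.1)
      ((volume.restrict (Ioc 0 R)).prod (volume.restrict (Ioi 0))) := by
  have hm : AEStronglyMeasurable (fun p : ℝ × ℝ => Real.exp (-(p.2 * p.1)) * Real.sin p.1)
      ((volume.restrict (Ioc 0 R)).prod (volume.restrict (Ioi 0))) :=
    (by fun_prop : Continuous _).aestronglyMeasurable
  refine (integrable_prod_iff hm).2 ⟨?_, ?_⟩
  · filter_upwards [ae_restrict_mem measurableSet_Ioc] with x hx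
    exact (integrableOn_Ioi_exp_neg_mul hx.1).mul_const _
  · refine Integrable.mono' (g := fun _ => (1 : ℝ)) (integrable_const _)
      hm.norm.integral_prod_right' ?_
    filter_upwards [ae_restrict_mem measurableSet_Ioc] with x hx
    simp only [norm_mul, Real.norm_eq_abs, Real.abs_exp]
    rw [integral_mul_const, integral_Ioi_exp_neg_mul hx.1, abs_of_nonneg (by
      have := hx.1; positivity)]
    rw [one_div, inv_mul_le_iff₀ hx.1, mul_one]
    exact (Real.abs_sin_le_abs).trans_eq (abs_of_pos hx.1)

/-- The Dirichlet integral, with a rate of convergence. -/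
lemma abs_integral_sinc_sub_le {R : ℝ} (hR : 0 < R) :
    |(∫ x in (0 : ℝ)..R, Real.sinc x) - Real.pi / 2| ≤ 2 / R := by
  have hint := integrable_exp_neg_mul_sin_prod R
  -- Write `1 / x` as the integral of `exp (-s x)` over `s > 0` and integrate in `x` first.
  have hswap := integral_integral_swap
    (f := fun x s : ℝ => Real.exp (-(s * x)) * Real.sin x) hint
  have hl : ∫ x in Ioc 0 R, ∫ s in Ioi (0 : ℝ), Real.exp (-(s * x)) * Real.sin x =
      ∫ x in (0 : ℝ)..R, Real.sinc x := by
    rw [intervalIntegral.integral_of_le hR.le]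
    refine setIntegral_congr_fun measurableSet_Ioc fun x hx => ?_
    rw [integral_mul_const, integral_Ioi_exp_neg_mul hx.1, Real.sinc_of_ne_zero hx.1.ne']
    ring
  have hr : ∀ s, ∫ x in Ioc 0 R, Real.exp (-(s * x)) * Real.sin x =
      (1 + s ^ 2)⁻¹ - Real.exp (-(s * R)) * (Real.cos R + s * Real.sin R) / (1 + s ^ 2) := by
    intro s
    rw [← intervalIntegral.integral_of_le hR.le, integral_exp_neg_mul_sin, sub_div, one_div]
  rw [hl] at hswap
  simp only [hr] at hswap
  have hbound : ∀ s ∈ Ioi (0 : ℝ),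
      ‖Real.exp (-(s * R)) * (Real.cos R + s * Real.sin R) / (1 + s ^ 2)‖ ≤
        2 * Real.exp (-(s * R)) := by
    intro s hs
    have hs : 0 < s := hs
    rw [norm_div, norm_mul, Real.norm_eq_abs, Real.norm_eq_abs, Real.norm_eq_abs, Real.abs_exp,
      abs_of_pos (show 0 < 1 + s ^ 2 by positivity), div_le_iff₀ (by positivity)]
    have h1 : |Real.cos R + s * Real.sin R| ≤ 1 + s := by
      refine (abs_add_le _ _).trans (add_le_add (Real.abs_cos_le_one R) ?_)
      rw [abs_mul, abs_of_pos hs]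
      exact mul_le_of_le_one_right hs.le (Real.abs_sin_le_one R)
    have h2 : 1 + s ≤ 2 * (1 + s ^ 2) := by nlinarith [sq_nonneg (s - 1)]
    nlinarith [mul_le_mul_of_nonneg_left (h1.trans h2) (Real.exp_pos (-(s * R))).le]
  have hbi : IntegrableOn (fun s => 2 * Real.exp (-(s * R))) (Ioi (0 : ℝ)) :=
    (integrableOn_Ioi_exp_neg_mul hR).const_mul 2
  have hei : IntegrableOn
      (fun s => Real.exp (-(s * R)) * (Real.cos R + s * Real.sin R) / (1 + s ^ 2))
      (Ioi (0 : ℝ)) := by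
    refine Integrable.mono' hbi ?_ ((ae_restrict_mem measurableSet_Ioi).mono hbound)
    refine (Continuous.div (by fun_prop) (by fun_prop) fun s => ?_).aestronglyMeasurable
    positivity
  rw [integral_sub integrable_inv_one_add_sq.integrableOn hei, integral_Ioi_inv_one_add_sq,
    Real.arctan_zero, sub_zero] at hswap
  rw [hswap, sub_sub_cancel_left, abs_neg, ← Real.norm_eq_abs]
  refine (norm_integral_le_of_norm_le hbi ((ae_restrict_mem measurableSet_Ioi).mono hbound)).trans ?_
  rw [integral_const_mul, integral_Ioi_exp_neg_mul hR]
  exact (mul_one_div 2 R).le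

/-! ### The functions `S` and `IS` -/

lemma continuous_sineS : Continuous sineS :=
  Real.continuous_sinc.comp (continuous_const.mul continuous_id)

lemma sineS_neg (x : ℝ) : sineS (-x) = sineS x := by
  simp [sineS, Real.sinc_neg]

lemma sineS_zero : sineS 0 = 1 := by simp [sineS]

lemma sineS_of_ne_zero {x : ℝ} (hx : x ≠ 0) :
    sineS x = Real.sin (Real.pi * x) / (Real.pi * x) :=
  Real.sinc_of_ne_zero (mul_ne_zero Real.pi_ne_zero hx)

lemma abs_sineS_le_one (x : ℝ) : |sineS x| ≤ 1 := Real.abs_sinc_le_one _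

lemma abs_sineS_le_inv {x : ℝ} (hx : 0 < x) : |sineS x| ≤ 1 / (3 * x) := by
  rw [sineS_of_ne_zero hx.ne', abs_div, abs_of_pos (show 0 < Real.pi * x by positivity)]
  have := Real.pi_gt_three
  gcongr
  exact Real.abs_sin_le_one _

lemma hasDerivAt_sineS {x : ℝ} (hx : x ≠ 0) :
    HasDerivAt sineS ((Real.cos (Real.pi * x) - sineS x) / x) x := by
  have h1 : HasDerivAt (fun x => Real.sin (Real.pi * x)) (Real.cos (Real.pi * x) * Real.pi) x := by
    simpa using ((hasDerivAt_id x).const_mul Real.pi).sin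
  have h2 : HasDerivAt (fun x => Real.pi * x) Real.pi x := by
    simpa using (hasDerivAt_id x).const_mul Real.pi
  have hpx : Real.pi * x ≠ 0 := mul_ne_zero Real.pi_ne_zero hx
  have h3 := h1.div h2 hpx
  refine (h3.congr_of_eventuallyEq ?_).congr_deriv ?_
  · filter_upwards [eventually_ne_nhds hx] with y hy
    exact sineS_of_ne_zero hy
  · rw [sineS_of_ne_zero hx]
    have := Real.pi_ne_zero
    field_simp

lemma deriv_sineS_neg (x : ℝ) : deriv sineS (-x) = -deriv sineS x := by
  have h : (fun y => sineS (-y)) = sineS := funext sineS_neg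
  have := deriv_comp_neg sineS x
  rw [h] at this
  linarith

lemma abs_deriv_sineS_le_inv {x : ℝ} (hx : 0 < x) : |deriv sineS x| ≤ 2 / x := by
  rw [(hasDerivAt_sineS hx.ne').deriv, abs_div, abs_of_pos hx]
  gcongr
  refine (abs_sub _ _).trans ?_
  linarith [Real.abs_cos_le_one (Real.pi * x), abs_sineS_le_one x]

/-- By the mean value theorem `sin u = u cos c` with `0 < c < u`, and `cos` is 1-Lipschitz. This
controls `S'` near `0`. -/
lemma abs_sin_sub_mul_cos_le {u : ℝ} (hu : 0 < u) :
    |Real.sin u - u * Real.cos u| ≤ u ^ 2 := by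
  obtain ⟨c, hc, h⟩ := exists_hasDerivAt_eq_slope Real.sin Real.cos hu
    Real.continuous_sin.continuousOn fun x _ => Real.hasDerivAt_sin x
  rw [Real.sin_zero, sub_zero, sub_zero, eq_div_iff hu.ne'] at h
  rw [← h, mul_comm, ← mul_sub, abs_mul, abs_of_pos hu, pow_two]
  have h2 : |Real.cos c - Real.cos u| ≤ |c - u| := by
    have := Real.lipschitzWith_cos.dist_le_mul c u
    simpa [Real.dist_eq] using this
  have h3 : |c - u| ≤ u := by
    rw [abs_sub_comm, abs_of_pos (by linarith [hc.2])]
    linarith [hc.1]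
  gcongr
  exact h2.trans h3

lemma abs_deriv_sineS_le {x : ℝ} (hx : 0 < x) : |deriv sineS x| ≤ 4 := by
  have hp := Real.pi_pos
  have h := abs_sin_sub_mul_cos_le (mul_pos hp hx)
  have : (Real.cos (Real.pi * x) - sineS x) / x =
      -(Real.sin (Real.pi * x) - Real.pi * x * Real.cos (Real.pi * x)) / (Real.pi * x ^ 2) := by
    rw [sineS_of_ne_zero hx.ne']
    field_simp
    ring
  rw [(hasDerivAt_sineS hx.ne').deriv, this, abs_div, abs_neg,
    abs_of_pos (show 0 < Real.pi * x ^ 2 by positivity), div_le_iff₀ (by positivity)]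
  refine h.trans ?_
  nlinarith [Real.pi_lt_four, mul_pos hp (pow_pos hx 2)]

lemma sineIS_eq (x : ℝ) : sineIS x = Real.pi⁻¹ * ∫ t in (0 : ℝ)..(Real.pi * x), Real.sinc t := by
  have := intervalIntegral.integral_comp_mul_left (a := 0) (b := x) Real.sinc Real.pi_ne_zero
  rw [mul_zero, smul_eq_mul] at this
  exact this

lemma abs_sineIS_sub_half_le {x : ℝ} (hx : 0 < x) : |sineIS x - 1 / 2| ≤ 1 / (4 * x) := by
  have hp := Real.pi_gt_three
  have h := abs_integral_sinc_sub_le (mul_pos Real.pi_pos hx)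
  have e : sineIS x - 1 / 2 =
      Real.pi⁻¹ * ((∫ t in (0 : ℝ)..(Real.pi * x), Real.sinc t) - Real.pi / 2) := by
    rw [sineIS_eq]
    field_simp
  rw [e, abs_mul, abs_of_pos (inv_pos.2 Real.pi_pos)]
  refine (mul_le_mul_of_nonneg_left h (inv_pos.2 Real.pi_pos).le).trans ?_
  rw [inv_mul_eq_div, div_div, div_le_div_iff₀ (by positivity) (by positivity)]
  -- The Dirichlet rate gives `2 / (π² x)`, and `π² > 8`.
  nlinarith [mul_pos hx (show 0 < Real.pi ^ 2 - 8 by nlinarith)]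

lemma hasDerivAt_sineIS (x : ℝ) : HasDerivAt sineIS (sineS x) x :=
  intervalIntegral.integral_hasDerivAt_right (continuous_sineS.intervalIntegrable _ _)
    (continuous_sineS.stronglyMeasurableAtFilter _ _) continuous_sineS.continuousAt

lemma continuous_sineIS : Continuous sineIS :=
  continuous_iff_continuousAt.2 fun x => (hasDerivAt_sineIS x).continuousAt

lemma sineIS_zero : sineIS 0 = 0 := by simp [sineIS]

lemma sineIS_neg (x : ℝ) : sineIS (-x) = -sineIS x := by
  have := intervalIntegral.integral_comp_neg (a := 0) (b := x) sineS
  simp only [sineS_neg, neg_zero] at this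
  rw [sineIS, sineIS, this, intervalIntegral.integral_symm]

lemma abs_sineIS_le {x : ℝ} (hx : 0 < x) : |sineIS x| ≤ x := by
  have := intervalIntegral.norm_integral_le_of_norm_le_const (a := 0) (b := x) (f := sineS)
    (C := 1) fun y _ => abs_sineS_le_one y
  simpa [sineIS, abs_of_pos hx] using this

lemma halfSign_neg (x : ℝ) : halfSign (-x) = -halfSign x := by
  simp [halfSign, Real.sign_neg]

lemma halfSign_of_pos {x : ℝ} (hx : 0 < x) : halfSign x = 1 / 2 := by
  simp [halfSign, Real.sign_of_pos hx]

/-! ### The truncated pair correlation: decay and total mass -/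

/-- The truncated pair correlation `S² - (IS - ε) S'` of the orthogonal sine process. -/
noncomputable def truncCorr (r : ℝ) : ℝ :=
  sineS r ^ 2 - (sineIS r - halfSign r) * deriv sineS r

lemma truncCorr_neg (r : ℝ) : truncCorr (-r) = truncCorr r := by
  simp only [truncCorr, sineS_neg, sineIS_neg, halfSign_neg, deriv_sineS_neg]
  ring

lemma truncCorr_abs (r : ℝ) : truncCorr |r| = truncCorr r := by
  rcases abs_choice r with h | h <;> rw [h]
  exact truncCorr_neg r

lemma abs_truncCorr_le_of_pos {r : ℝ} (hr : 0 < r) : |truncCorr r| ≤ 14 / (1 + r ^ 2) := by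
  rw [truncCorr, halfSign_of_pos hr, le_div_iff₀ (by positivity)]
  have h1 : |sineS r ^ 2 - (sineIS r - 1 / 2) * deriv sineS r| ≤
      |sineS r| ^ 2 + |sineIS r - 1 / 2| * |deriv sineS r| := by
    refine (abs_sub _ _).trans ?_
    rw [abs_pow, abs_mul]
  -- For `r ≤ 1` the bound is `1 + 6 = 7` and `1 + r² ≤ 2`, whence `14`. For `r ≥ 1` both terms are
  -- `O(1/r²)`, the second because `IS - 1/2` and `S'` are each `O(1/r)`.
  rcases le_total r 1 with h | h
  · have h2 : |sineIS r - 1 / 2| ≤ 3 / 2 := by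
      have := abs_le.1 (abs_sineIS_le hr)
      exact abs_le.2 ⟨by linarith, by linarith⟩
    have h3 : |sineIS r - 1 / 2| * |deriv sineS r| ≤ 3 / 2 * 4 :=
      mul_le_mul h2 (abs_deriv_sineS_le hr) (abs_nonneg _) (by norm_num)
    have h4 : |sineS r| ^ 2 ≤ 1 := pow_le_one₀ (abs_nonneg _) (abs_sineS_le_one r)
    nlinarith [abs_nonneg (sineS r ^ 2 - (sineIS r - 1 / 2) * deriv sineS r)]
  · have h3 : |sineIS r - 1 / 2| * |deriv sineS r| ≤ 1 / (4 * r) * (2 / r) :=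
      mul_le_mul (abs_sineIS_sub_half_le hr) (abs_deriv_sineS_le_inv hr) (abs_nonneg _)
        (by positivity)
    have h4 : |sineS r| ^ 2 ≤ (1 / (3 * r)) ^ 2 :=
      pow_le_pow_left₀ (abs_nonneg _) (abs_sineS_le_inv hr) 2
    have h5 : |sineS r ^ 2 - (sineIS r - 1 / 2) * deriv sineS r| ≤ 1 / r ^ 2 := by
      refine (h1.trans (add_le_add h4 h3)).trans ?_
      rw [le_div_iff₀ (by positivity)]
      field_simp
      norm_num
    calc _ ≤ 1 / r ^ 2 * (1 + r ^ 2) := by gcongr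
      _ ≤ 14 := by
        rw [one_div, inv_mul_le_iff₀ (by positivity)]
        nlinarith

lemma abs_truncCorr_le (r : ℝ) : |truncCorr r| ≤ 14 / (1 + r ^ 2) := by
  rcases lt_trichotomy r 0 with h | h | h
  · have := abs_truncCorr_le_of_pos (neg_pos.2 h)
    rwa [truncCorr_neg, neg_sq] at this
  · subst h
    simp [truncCorr, sineS_zero, sineIS_zero, halfSign]
  · exact abs_truncCorr_le_of_pos h

lemma measurable_truncCorr : Measurable truncCorr := by
  have h : Measurable halfSign := by
    have : Measurable Real.sign := by
      unfold Real.sign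
      exact Measurable.ite measurableSet_Iio measurable_const
        (Measurable.ite measurableSet_Ioi measurable_const measurable_const)
    exact this.const_mul _
  exact (continuous_sineS.measurable.pow_const 2).sub
    ((continuous_sineIS.measurable.sub h).mul (measurable_deriv _))

lemma integrable_truncCorr : Integrable truncCorr := by
  refine Integrable.mono' (integrable_inv_one_add_sq.const_mul 14)
    measurable_truncCorr.aestronglyMeasurable (ae_of_all _ fun r => ?_)
  simpa [div_eq_mul_inv] using abs_truncCorr_le r

lemma integral_Ioi_truncCorr : ∫ r in Ioi (0 : ℝ), truncCorr r = 1 / 2 := by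
  -- An explicit antiderivative: with `r S' = cos (π r) - S` and `S(2r) = S(r) cos (π r)` the cosine
  -- terms cancel. It runs from `G 0 = 1/2` to the limit `1`.
  set G : ℝ → ℝ := fun r => -((sineIS r - 1 / 2) * sineS r) + 2 * sineIS (2 * r) -
    2 * (r * sineS r ^ 2) with hG
  have hc : Continuous G := by
    have := continuous_sineIS
    have := continuous_sineS
    fun_prop
  have hd : ∀ r ∈ Ioi (0 : ℝ), HasDerivAt G (truncCorr r) r := by
    intro r hr
    have hr : 0 < r := hr
    have hS := hasDerivAt_sineS hr.ne'
    have h1 : HasDerivAt (fun r => sineIS (2 * r)) (sineS (2 * r) * 2) r := by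
      have := (hasDerivAt_sineIS (2 * r)).comp r ((hasDerivAt_id r).const_mul 2)
      simpa [Function.comp_def] using this
    have h2 := (((((hasDerivAt_sineIS r).sub_const (1 / 2)).mul hS).neg.add
      (h1.const_mul 2)).sub (((hasDerivAt_id r).mul (hS.pow 2)).const_mul 2))
    refine h2.congr_deriv ?_
    rw [truncCorr, halfSign_of_pos hr, hS.deriv]
    have h3 : sineS (2 * r) = sineS r * Real.cos (Real.pi * r) := by
      rw [sineS_of_ne_zero hr.ne', sineS_of_ne_zero (by positivity),
        show Real.pi * (2 * r) = 2 * (Real.pi * r) by ring, Real.sin_two_mul]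
      have := Real.pi_ne_zero
      field_simp
    rw [h3]
    simp
    field_simp
    ring
  have hS0 : Tendsto sineS atTop (𝓝 0) := by
    refine squeeze_zero_norm' (a := fun r => 1 / 3 * r⁻¹) ?_ ?_
    · filter_upwards [eventually_gt_atTop 0] with r hr
      refine (abs_sineS_le_inv hr).trans_eq ?_
      field_simp
    · simpa using tendsto_inv_atTop_zero.const_mul (1 / 3 : ℝ)
  have hrS : Tendsto (fun r => r * sineS r ^ 2) atTop (𝓝 0) := by
    refine squeeze_zero_norm' (a := fun r => 1 / 9 * r⁻¹) ?_ ?_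
    · filter_upwards [eventually_gt_atTop 0] with r hr
      rw [norm_mul, norm_pow, Real.norm_eq_abs, Real.norm_eq_abs, abs_of_pos hr]
      refine (mul_le_mul_of_nonneg_left
        (pow_le_pow_left₀ (abs_nonneg _) (abs_sineS_le_inv hr) 2) hr.le).trans_eq ?_
      field_simp
      norm_num
    · simpa using tendsto_inv_atTop_zero.const_mul (1 / 9 : ℝ)
  have hIS : Tendsto sineIS atTop (𝓝 (1 / 2)) := by
    rw [tendsto_iff_norm_sub_tendsto_zero]
    refine squeeze_zero' (g := fun r => 1 / 4 * r⁻¹) (Eventually.of_forall fun _ => norm_nonneg _)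
      ?_ ?_
    · filter_upwards [eventually_gt_atTop 0] with r hr
      refine (abs_sineIS_sub_half_le hr).trans_eq ?_
      field_simp
    · simpa using tendsto_inv_atTop_zero.const_mul (1 / 4 : ℝ)
  have hlim : Tendsto G atTop (𝓝 1) := by
    have h2 : Tendsto (fun r => sineIS (2 * r)) atTop (𝓝 (1 / 2)) :=
      hIS.comp (tendsto_id.const_mul_atTop two_pos)
    have := ((((hIS.sub_const (1 / 2)).mul hS0).neg).add (h2.const_mul 2)).sub (hrS.const_mul 2)
    convert this using 2
    norm_num
  rw [integral_Ioi_of_hasDerivAt_of_tendsto hc.continuousWithinAt hd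
    integrable_truncCorr.integrableOn hlim]
  simp [hG, sineIS_zero, sineS_zero]
  norm_num

lemma integral_truncCorr : ∫ r, truncCorr r = 1 := by
  have h := integral_comp_abs (f := truncCorr)
  simp only [truncCorr_abs] at h
  rw [h, integral_Ioi_truncCorr]
  norm_num

/-! ### Pfaffians of order one and two -/

lemma pfaffian_one (A : Matrix (Fin 1 × Fin 2) (Fin 1 × Fin 2) ℂ) :
    pfaffian A = (A (0, 0) (0, 1) - A (0, 1) (0, 0)) / 2 := by
  unfold pfaffian
  rw [← Equiv.sum_comp (Equiv.permCongr (finProdFinEquiv (m := 1) (n := 2)).symm)]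
  rw [← Equiv.sum_comp (Equiv.Perm.decomposeFin (n := 1)).symm]
  rw [Fintype.sum_prod_type]
  simp [Fin.sum_univ_succ, finProdFinEquiv, Fin.divNat, Fin.modNat,Equiv.permCongr_apply]
  ring

lemma pfaffian_two (A : Matrix (Fin 2 × Fin 2) (Fin 2 × Fin 2) ℂ) (hA : A.transpose = -A) :
    pfaffian A = A (0, 0) (0, 1) * A (1, 0) (1, 1) - A (0, 0) (1, 0) * A (0, 1) (1, 1) +
      A (0, 0) (1, 1) * A (0, 1) (1, 0) := by
  have h : ∀ i j, A j i = - A i j := fun i j => congrFun (congrFun hA i) j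
  unfold pfaffian
  -- Transport to permutations of `Fin 4` and split off the image of `0` repeatedly, so that all 24
  -- terms are enumerated; antisymmetry then merges them into three.
  rw [← Equiv.sum_comp (Equiv.permCongr (finProdFinEquiv (m := 2) (n := 2)).symm)]
  rw [← Equiv.sum_comp (Equiv.Perm.decomposeFin (n := 3)).symm]
  rw [Fintype.sum_prod_type]
  simp_rw [← Equiv.sum_comp (Equiv.Perm.decomposeFin (n := 2)).symm]
  simp_rw [Fintype.sum_prod_type]
  simp_rw [← Equiv.sum_comp (Equiv.Perm.decomposeFin (n := 1)).symm]
  simp_rw [Fintype.sum_prod_type]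
  have h2 : ∀ (e : Equiv.Perm (Fin 3)) (p : Fin 4), Equiv.Perm.decomposeFin.symm (p, e) 2 =
      Equiv.swap 0 p (e 1).succ := fun e p => Equiv.Perm.decomposeFin_symm_apply_succ e p 1
  have h3 : ∀ (e : Equiv.Perm (Fin 3)) (p : Fin 4), Equiv.Perm.decomposeFin.symm (p, e) 3 =
      Equiv.swap 0 p (e 2).succ := fun e p => Equiv.Perm.decomposeFin_symm_apply_succ e p 2
  have h4 : ∀ (e : Equiv.Perm (Fin 2)) (p : Fin 3), Equiv.Perm.decomposeFin.symm (p, e) 2 =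
      Equiv.swap 0 p (e 1).succ := fun e p => Equiv.Perm.decomposeFin_symm_apply_succ e p 1
  simp [Fin.sum_univ_succ, finProdFinEquiv, Fin.divNat, Fin.modNat, Equiv.permCongr_apply,
    h2, h3, h4, Equiv.swap_apply_def]
  rw [h (0, 0) (0, 1), h (0, 0) (1, 0), h (0, 0) (1, 1), h (0, 1) (1, 0), h (0, 1) (1, 1),
    h (1, 0) (1, 1)]
  ring

lemma sineKernelOne_mul_matJ (x y : ℝ) :
    sineKernelOne x y * matJ =
      !![-((sineIS (x - y) - halfSign (x - y) : ℝ) : ℂ), (sineS (x - y) : ℂ);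
        -(sineS (x - y) : ℂ), ((deriv sineS (x - y) : ℝ) : ℂ)] := by
  ext i j
  fin_cases i <;> fin_cases j <;> simp [sineKernelOne, matJ]

lemma pfaffian_sineKernelOne_one (x : Fin 1 → ℝ) :
    pfaffian (blockMatrix sineKernelOne x) = 1 := by
  rw [pfaffian_one]
  simp [blockMatrix, sineKernelOne_mul_matJ, sineS_zero]

lemma pfaffian_sineKernelOne_two (x : Fin 2 → ℝ) :
    pfaffian (blockMatrix sineKernelOne x) = ((1 - truncCorr (x 0 - x 1) : ℝ) : ℂ) := by
  have h0 : sineIS 0 - halfSign 0 = 0 := by simp [sineIS_zero, halfSign]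
  -- Oddness of the derivative gives this without differentiability at `0`.
  have h1 : deriv sineS 0 = 0 := by
    have := deriv_sineS_neg 0
    rw [neg_zero] at this
    linarith
  rw [pfaffian_two]
  · simp [blockMatrix, sineKernelOne_mul_matJ, sineS_zero, truncCorr]
    ring
  · ext ⟨i, a⟩ ⟨j, b⟩
    have e : x j - x i = -(x i - x j) := by ring
    simp only [blockMatrix, sineKernelOne_mul_matJ, Matrix.transpose_apply, Matrix.of_apply,
      Matrix.neg_apply, e, sineIS_neg, halfSign_neg, sineS_neg, deriv_sineS_neg]
    fin_cases a <;> fin_cases b <;> simp <;> ring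

/-! ### Configurations as sums of point masses -/

lemma Conf.measure_lt_one_eq_zero (ξ : Conf) {s : Set ℝ} (hs : MeasurableSet s)
    (h : ξ.toMeasure s < 1) : ξ.toMeasure s = 0 := by
  obtain ⟨n, hn⟩ := ξ.integerValued s hs
  rw [hn] at h ⊢
  have : n < 1 := by exact_mod_cast h
  simp [Order.lt_one_iff.1 this]

/-- By outer regularity a non-atom has a neighbourhood of mass below `1`, hence of mass `0` by
integrality; local nullity suffices on the line. -/
lemma Conf.measure_nonatoms (ξ : Conf) : ξ.toMeasure {x | ξ.toMeasure {x} = 0} = 0 := by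
  have := ξ.locallyFinite
  refine measure_null_of_locally_null _ fun x hx => ?_
  have hx : ξ.toMeasure {x} < 1 := by
    rw [show ξ.toMeasure {x} = 0 from hx]
    exact one_pos
  obtain ⟨U, hxU, hU, hlt⟩ := Set.exists_isOpen_lt_of_lt _ _ hx
  exact ⟨U, mem_nhdsWithin_of_mem_nhds (hU.mem_nhds (hxU rfl)),
    ξ.measure_lt_one_eq_zero hU.measurableSet hlt⟩

/-- Every atom has mass at least `1`, while `K` has finite mass. -/
lemma Conf.finite_atoms_inter (ξ : Conf) {K : Set ℝ} (hK : IsCompact K) :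
    (K ∩ {x | ξ.toMeasure {x} ≠ 0}).Finite := by
  have := ξ.locallyFinite
  have h := Measure.finite_const_le_meas_of_disjoint_iUnion ξ.toMeasure (ε := 1) one_pos
    (As := fun x : K => {(x : ℝ)}) (fun _ => measurableSet_singleton _)
    (fun x y hxy => by simpa [Function.onFun] using fun h => hxy (Subtype.ext h))
    (by
      rw [Set.iUnion_singleton_eq_range, Subtype.range_coe]
      exact hK.measure_ne_top)
  refine (h.image Subtype.val).subset ?_
  rintro x ⟨hxK, hx⟩
  refine ⟨⟨x, hxK⟩, ?_, rfl⟩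
  by_contra hlt
  exact hx (ξ.measure_lt_one_eq_zero (measurableSet_singleton x) (not_le.1 hlt))

lemma Conf.IsSimple.exists_finset {ξ : Conf} (hξ : ξ.IsSimple) {K : Set ℝ} (hK : IsCompact K) :
    ∃ F : Finset ℝ, (∀ x, x ∈ F ↔ x ∈ K ∧ ξ.toMeasure {x} ≠ 0) ∧
      ∀ f : ℝ → ℝ, Function.support f ⊆ K → ∫ x, f x ∂ξ.toMeasure = ∑ x ∈ F, f x := by
  have := ξ.locallyFinite
  refine ⟨(ξ.finite_atoms_inter hK).toFinset, fun x => by simp, fun f hf => ?_⟩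
  rw [← setIntegral_eq_integral_of_forall_compl_eq_zero (s := K) fun x hx =>
    Function.notMem_support.1 fun h => hx (hf h)]
  have hae : (K : Set ℝ) =ᵐ[ξ.toMeasure] ((ξ.finite_atoms_inter hK).toFinset : Set ℝ) := by
    rw [Finite.coe_toFinset]
    refine (inter_ae_eq_left_of_ae_eq_univ ?_).symm
    refine eventuallyEq_univ.2 (mem_ae_iff.2 ?_)
    convert ξ.measure_nonatoms using 2
    ext x
    simp
  have h1 : ∀ x ∈ (ξ.finite_atoms_inter hK).toFinset, ξ.toMeasure {x} = 1 := by
    intro x hx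
    simp only [Finite.mem_toFinset, mem_inter_iff, mem_ofPred_eq] at hx
    exact (hξ x).resolve_left hx.2
  rw [setIntegral_congr_set hae, setIntegral_finset]
  · refine Finset.sum_congr rfl fun x hx => ?_
    simp [Measure.real, h1 x hx]
  · rw [← (((ξ.finite_atoms_inter hK).toFinset : Finset ℝ) : Set ℝ).biUnion_of_singleton]
    refine integrableOn_finset_iUnion.2 fun x hx => integrableOn_singleton (by finiteness) ?_
    simp [h1 x hx]

/-! ### Linear statistics -/

/-- The test function `x ↦ f (x 0)` on one-point tuples. -/
noncomputable def testOne (f : C_c(ℝ, ℝ)) : C_c(Fin 1 → ℝ, ℂ) where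
  toFun x := (f (x 0) : ℂ)
  continuous_toFun := by fun_prop
  hasCompactSupport' := by
    refine HasCompactSupport.intro (isCompact_univ_pi fun _ : Fin 1 => f.hasCompactSupport)
      fun x hx => ?_
    simp only [mem_univ_pi, not_forall] at hx
    obtain ⟨i, hi⟩ := hx
    rw [Subsingleton.elim i 0] at hi
    simp [image_eq_zero_of_notMem_tsupport hi]

/-- The test function `x ↦ f (x 0) * g (x 1)` on pairs. -/
noncomputable def testTwo (f g : C_c(ℝ, ℝ)) : C_c(Fin 2 → ℝ, ℂ) where
  toFun x := ((f (x 0) * g (x 1) : ℝ) : ℂ)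
  continuous_toFun := by fun_prop
  hasCompactSupport' := by
    refine HasCompactSupport.intro (isCompact_univ_pi fun _ : Fin 2 =>
      f.hasCompactSupport.union g.hasCompactSupport) fun x hx => ?_
    simp only [mem_univ_pi, not_forall] at hx
    obtain ⟨i, hi⟩ := hx
    rw [mem_union, not_or] at hi
    fin_cases i
    · have : f (x 0) = 0 := image_eq_zero_of_notMem_tsupport hi.1
      simp [this]
    · have : g (x 1) = 0 := image_eq_zero_of_notMem_tsupport hi.2
      simp [this]

lemma Conf.IsSimple.distinctSum_testOne {ξ : Conf} (hξ : ξ.IsSimple) (f : C_c(ℝ, ℝ)) :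
    ξ.distinctSum (testOne f) = ((∫ x, f x ∂ξ.toMeasure : ℝ) : ℂ) := by
  obtain ⟨F, hF, hsum⟩ := hξ.exists_finset f.hasCompactSupport
  rw [hsum f (subset_tsupport f), Conf.distinctSum,
    tsum_subtype (ξ.distinctTuples 1) (fun x => testOne f x),
    ← (Equiv.funUnique (Fin 1) ℝ).symm.tsum_eq, tsum_eq_sum (s := F)]
  · push_cast
    refine Finset.sum_congr rfl fun x hx => ?_
    rw [indicator_of_mem]
    · rfl
    · exact ⟨Function.injective_of_subsingleton _, fun _ => ((hF x).1 hx).2⟩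
  · intro x hx
    by_cases hm : (Equiv.funUnique (Fin 1) ℝ).symm x ∈ ξ.distinctTuples 1
    · rw [indicator_of_mem hm]
      have : x ∉ tsupport f := fun h => hx ((hF x).2 ⟨h, hm.2 0⟩)
      exact Complex.ofReal_eq_zero.2 (image_eq_zero_of_notMem_tsupport this)
    · exact indicator_of_notMem hm _

/-- The product of the two linear statistics sums over all pairs of points; removing the diagonal
subtracts the statistic of `f g`. -/
lemma Conf.IsSimple.distinctSum_testTwo {ξ : Conf} (hξ : ξ.IsSimple) (f g : C_c(ℝ, ℝ)) :
    ξ.distinctSum (testTwo f g) =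
      (((∫ x, f x ∂ξ.toMeasure) * (∫ x, g x ∂ξ.toMeasure) - ∫ x, f x * g x ∂ξ.toMeasure : ℝ) :
        ℂ) := by
  obtain ⟨F, hF, hsum⟩ := hξ.exists_finset (f.hasCompactSupport.union g.hasCompactSupport)
  have hf := (subset_tsupport f).trans (subset_union_left (t := tsupport g))
  have hg := (subset_tsupport g).trans (subset_union_right (s := tsupport f))
  have hfg : Function.support (fun x => f x * g x) ⊆ tsupport f ∪ tsupport g :=
    (Function.support_mul_subset_left _ _).trans hf
  rw [hsum f hf, hsum g hg, hsum _ hfg, Conf.distinctSum,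
    tsum_subtype (ξ.distinctTuples 2) (fun x => testTwo f g x),
    ← (finTwoArrowEquiv ℝ).symm.tsum_eq, tsum_eq_sum (s := F ×ˢ F)]
  · have hmem : ∀ p ∈ F ×ˢ F, (ξ.distinctTuples 2).indicator (fun x => testTwo f g x)
        ((finTwoArrowEquiv ℝ).symm p) =
          ((f p.1 * g p.2 - if p.1 = p.2 then f p.1 * g p.1 else 0 : ℝ) : ℂ) := by
      rintro ⟨x, y⟩ hp
      obtain ⟨hx, hy⟩ := Finset.mem_product.1 hp
      by_cases hxy : x = y
      · subst hxy
        rw [indicator_of_notMem]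
        · simp
        · intro h
          have := h.1 (show (finTwoArrowEquiv ℝ).symm (x, x) 0 = (finTwoArrowEquiv ℝ).symm (x, x) 1
            from rfl)
          exact absurd this (by decide)
      · rw [indicator_of_mem]
        · simp [hxy, testTwo]
        · refine ⟨fun i j hij => ?_, fun i => ?_⟩
          · fin_cases i <;> fin_cases j
            · rfl
            · exact absurd hij hxy
            · exact absurd hij.symm hxy
            · rfl
          · fin_cases i
            · exact ((hF x).1 hx).2
            · exact ((hF y).1 hy).2
    rw [Finset.sum_congr rfl hmem, ← Complex.ofReal_sum, Finset.sum_sub_distrib,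
      Finset.sum_mul_sum, Finset.sum_product, Finset.sum_product]
    congr 2
    refine Finset.sum_congr rfl fun x hx => ?_
    simp [hx]
  · rintro ⟨x, y⟩ hp
    by_cases hm : (finTwoArrowEquiv ℝ).symm (x, y) ∈ ξ.distinctTuples 2
    · rw [indicator_of_mem hm]
      refine Complex.ofReal_eq_zero.2 ?_
      change f x * g y = 0
      rw [Finset.mem_product, not_and_or] at hp
      rcases hp with h | h
      · have : x ∉ Function.support f := fun h' => h ((hF x).2 ⟨hf h', hm.2 0⟩)
        rw [Function.notMem_support.1 this, zero_mul]
      · have : y ∉ Function.support g := fun h' => h ((hF y).2 ⟨hg h', hm.2 1⟩)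
        rw [Function.notMem_support.1 this, mul_zero]
    · exact indicator_of_notMem hm _

/-! ### Moments of linear statistics -/

/-- The centred linear statistic of a test function, for a process of unit intensity. -/
noncomputable def centredStat (f : C_c(ℝ, ℝ)) (ξ : Conf) : ℝ :=
  ∫ x, f x ∂ξ.toMeasure - ∫ x, f x

lemma integrable_volume_of_compactSupport (f : C_c(ℝ, ℝ)) : Integrable f :=
  f.continuous.integrable_of_hasCompactSupport f.hasCompactSupport

/-- The average of the second differences of `g` against the truncated pair correlation. -/
noncomputable def corrDiff (g : ℝ → ℝ) (x : ℝ) : ℝ :=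
  ∫ r, truncCorr r * (g x - (g (x + r) + g (x - r)) / 2)

lemma integrable_truncCorr_mul {g : ℝ → ℝ} (hg : Continuous g) {C : ℝ} (hC : ∀ x, |g x| ≤ C)
    {a : ℝ → ℝ} (ha : Continuous a) : Integrable fun r => truncCorr r * g (a r) :=
  integrable_truncCorr.mul_bdd (c := C) (hg.comp ha).aestronglyMeasurable (ae_of_all _ fun _ => hC _)

/-- Unit mass of `truncCorr` turns `g x` into an average, and evenness allows the shifts by `r` and
`-r` to be averaged, producing second differences. -/
lemma integral_mul_truncCorr_sub {g : ℝ → ℝ} (hg : Continuous g) {C : ℝ} (hC : ∀ x, |g x| ≤ C)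
    (x : ℝ) : ∫ y, g y * truncCorr (x - y) = g x - corrDiff g x := by
  have hp := integrable_truncCorr_mul hg hC (a := fun r => x + r) (by fun_prop)
  have hm := integrable_truncCorr_mul hg hC (a := fun r => x - r) (by fun_prop)
  have h1 : ∫ y, g y * truncCorr (x - y) = ∫ r, truncCorr r * g (x - r) := by
    rw [← integral_sub_left_eq_self (fun r => truncCorr r * g (x - r)) volume x]
    simp [mul_comm]
  have h2 : ∫ r, truncCorr r * g (x + r) = ∫ r, truncCorr r * g (x - r) := by
    rw [← integral_neg_eq_self (fun r => truncCorr r * g (x - r))]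
    simp [truncCorr_neg]
  have h3 : corrDiff g x = g x - (∫ r, truncCorr r * g (x + r)) / 2 -
      (∫ r, truncCorr r * g (x - r)) / 2 := by
    calc corrDiff g x = ∫ r, (truncCorr r * g x - truncCorr r * g (x + r) / 2 -
          truncCorr r * g (x - r) / 2) :=
        integral_congr_ae (ae_of_all _ fun r => by ring)
      _ = _ := by
        rw [integral_sub _ (hm.div_const 2), integral_sub (integrable_truncCorr.mul_const _)
          (hp.div_const 2), integral_mul_const, integral_truncCorr, integral_div, integral_div,
          one_mul]
        exact (integrable_truncCorr.mul_const _).sub (hp.div_const 2)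
  rw [h1, h3, h2]
  ring

lemma integrable_mul_mul_truncCorr (f g : C_c(ℝ, ℝ)) :
    Integrable (fun p : ℝ × ℝ => f p.1 * g p.2 * truncCorr (p.1 - p.2)) (volume.prod volume) := by
  refine ((integrable_volume_of_compactSupport f).mul_prod
    (integrable_volume_of_compactSupport g)).mul_bdd (c := 14)
    (measurable_truncCorr.comp (measurable_fst.sub measurable_snd)).aestronglyMeasurable
    (ae_of_all _ fun p => ?_)
  refine (abs_truncCorr_le _).trans (div_le_self (by norm_num) ?_)
  nlinarith [sq_nonneg (p.1 - p.2)]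

lemma integral_mul_mul_truncCorr (f g : C_c(ℝ, ℝ)) (x : ℝ) :
    ∫ y, f x * g y * truncCorr (x - y) = f x * (g x - corrDiff g x) := by
  obtain ⟨C, hC⟩ : ∃ C, ∀ x, |g x| ≤ C :=
    g.continuous.bounded_above_of_compact_support g.hasCompactSupport
  simp_rw [mul_assoc, integral_const_mul]
  rw [integral_mul_truncCorr_sub (map_continuous g) hC]

lemma integrable_mul_corrDiff (f g : C_c(ℝ, ℝ)) : Integrable fun x => f x * corrDiff g x := by
  -- The Fubini marginal is `f (g - corrDiff g)`, so no separate measurability argument for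
  -- `corrDiff` is needed.
  have h := (integrable_mul_mul_truncCorr f g).integral_prod_left
  simp only [integral_mul_mul_truncCorr] at h
  refine ((integrable_volume_of_compactSupport (f * g)).sub h).congr
    (ae_of_all _ fun x => ?_)
  simp
  ring

lemma integral_testTwo_mul (f g : C_c(ℝ, ℝ)) :
    ∫ x, testTwo f g x * ((1 - truncCorr (x 0 - x 1) : ℝ) : ℂ) =
      (((∫ x, f x) * (∫ x, g x) - ∫ x, f x * (g x - corrDiff g x) : ℝ) : ℂ) := by
  have hfg : Integrable (fun p : ℝ × ℝ => f p.1 * g p.2) (volume.prod volume) :=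
    (integrable_volume_of_compactSupport f).mul_prod
      (integrable_volume_of_compactSupport g)
  have hfgT := integrable_mul_mul_truncCorr f g
  have h1 : ∀ x : Fin 2 → ℝ, testTwo f g x * ((1 - truncCorr (x 0 - x 1) : ℝ) : ℂ) =
      ((f (x 0) * g (x 1) - f (x 0) * g (x 1) * truncCorr (x 0 - x 1) : ℝ) : ℂ) := by
    intro x
    rw [show testTwo f g x = ((f (x 0) * g (x 1) : ℝ) : ℂ) from rfl]
    push_cast
    ring
  simp_rw [h1]
  rw [integral_complex_ofReal, ← (volume_preserving_finTwoArrow ℝ).symm.integral_comp']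
  change ((∫ p : ℝ × ℝ, (f p.1 * g p.2 - f p.1 * g p.2 * truncCorr (p.1 - p.2))
    ∂(volume.prod volume) : ℝ) : ℂ) = _
  rw [integral_sub hfg hfgT, integral_prod_mul, integral_prod _ hfgT]
  simp_rw [integral_mul_mul_truncCorr]

lemma ae_distinctSum_testOne {P : Measure Conf}
    (hP : IsPfaffianProcess P sineKernelOne) (f : C_c(ℝ, ℝ)) :
    (fun ξ : Conf => ξ.distinctSum (testOne f)) =ᵐ[P]
      fun ξ => ((∫ x, f x ∂ξ.toMeasure : ℝ) : ℂ) := by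
  filter_upwards [hP.simple] with ξ hξ using hξ.distinctSum_testOne f

lemma integrable_linStat {P : Measure Conf}
    (hP : IsPfaffianProcess P sineKernelOne) (f : C_c(ℝ, ℝ)) :
    Integrable (fun ξ : Conf => ∫ x, f x ∂ξ.toMeasure) P := by
  obtain ⟨ρ, hρ, -⟩ := hP.correlation 1 one_pos
  exact (((hρ.integrable (testOne f)).congr (ae_distinctSum_testOne hP f))).re

lemma integral_linStat {P : Measure Conf}
    (hP : IsPfaffianProcess P sineKernelOne) (f : C_c(ℝ, ℝ)) :
    ∫ ξ, ∫ x, f x ∂ξ.toMeasure ∂P = ∫ x, f x := by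
  obtain ⟨ρ, hρ, hρ'⟩ := hP.correlation 1 one_pos
  have h := hρ.integral_eq (testOne f)
  rw [integral_congr_ae (ae_distinctSum_testOne hP f), integral_complex_ofReal] at h
  simp_rw [hρ', pfaffian_sineKernelOne_one, mul_one] at h
  rw [show (fun x => testOne f x) = fun x : Fin 1 → ℝ => ((f (x 0) : ℝ) : ℂ) from rfl,
    integral_complex_ofReal, show ∫ x : Fin 1 → ℝ, f (x 0) = ∫ x, f x from
      (volume_preserving_funUnique (Fin 1) ℝ).integral_comp' f] at h
  exact_mod_cast h

lemma ae_distinctSum_testTwo {P : Measure Conf}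
    (hP : IsPfaffianProcess P sineKernelOne) (f g : C_c(ℝ, ℝ)) :
    (fun ξ : Conf => ξ.distinctSum (testTwo f g)) =ᵐ[P]
      fun ξ => (((∫ x, f x ∂ξ.toMeasure) * (∫ x, g x ∂ξ.toMeasure) -
        ∫ x, (f * g) x ∂ξ.toMeasure : ℝ) : ℂ) := by
  filter_upwards [hP.simple] with ξ hξ using hξ.distinctSum_testTwo f g

lemma integrable_linStat_mul {P : Measure Conf}
    (hP : IsPfaffianProcess P sineKernelOne) (f g : C_c(ℝ, ℝ)) :
    Integrable (fun ξ : Conf => (∫ x, f x ∂ξ.toMeasure) * (∫ x, g x ∂ξ.toMeasure)) P := by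
  obtain ⟨ρ, hρ, -⟩ := hP.correlation 2 two_pos
  have h := (((hρ.integrable (testTwo f g)).congr (ae_distinctSum_testTwo hP f g))).re
  refine (h.add (integrable_linStat hP (f * g))).congr (ae_of_all _ fun ξ => ?_)
  simp

/-- The diagonal contribution `∫ f g` cancels against the `∫ f g` split off from the truncated
correlation by the sum rule. -/
lemma integral_linStat_mul {P : Measure Conf}
    (hP : IsPfaffianProcess P sineKernelOne) (f g : C_c(ℝ, ℝ)) :
    ∫ ξ : Conf, (∫ x, f x ∂ξ.toMeasure) * (∫ x, g x ∂ξ.toMeasure) ∂P =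
      (∫ x, f x) * (∫ x, g x) + ∫ x, f x * corrDiff g x := by
  obtain ⟨ρ, hρ, hρ'⟩ := hP.correlation 2 two_pos
  have h := hρ.integral_eq (testTwo f g)
  rw [integral_congr_ae (ae_distinctSum_testTwo hP f g), integral_complex_ofReal] at h
  simp_rw [hρ', pfaffian_sineKernelOne_two] at h
  rw [integral_testTwo_mul] at h
  have h := Complex.ofReal_injective h
  rw [integral_sub (integrable_linStat_mul hP f g) (integrable_linStat hP (f * g)),
    integral_linStat hP (f * g)] at h
  have h2 : ∫ x, f x * (g x - corrDiff g x) = (∫ x, (f * g) x) - ∫ x, f x * corrDiff g x := by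
    rw [← integral_sub (integrable_volume_of_compactSupport (f * g))
      (integrable_mul_corrDiff f g)]
    exact integral_congr_ae (ae_of_all _ fun x => mul_sub _ _ _)
  rw [h2] at h
  linarith

lemma integrable_centredStat_mul {P : Measure Conf}
    (hP : IsPfaffianProcess P sineKernelOne) (f g : C_c(ℝ, ℝ)) :
    Integrable (fun ξ => centredStat f ξ * centredStat g ξ) P := by
  have := hP.isProbability
  refine ((((integrable_linStat_mul hP f g).sub ((integrable_linStat hP f).mul_const
    (∫ x, g x))).sub ((integrable_linStat hP g).const_mul (∫ x, f x))).add
    (integrable_const ((∫ x, f x) * ∫ x, g x))).congr (ae_of_all _ fun ξ => ?_)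
  simp only [centredStat, Pi.add_apply, Pi.sub_apply]
  ring

lemma integral_centredStat_mul {P : Measure Conf}
    (hP : IsPfaffianProcess P sineKernelOne) (f g : C_c(ℝ, ℝ)) :
    ∫ ξ, centredStat f ξ * centredStat g ξ ∂P = ∫ x, f x * corrDiff g x := by
  have := hP.isProbability
  have hf := integrable_linStat hP f
  have hg := integrable_linStat hP g
  have hfg := integrable_linStat_mul hP f g
  calc ∫ ξ, centredStat f ξ * centredStat g ξ ∂P
      = ∫ ξ, ((∫ x, f x ∂ξ.toMeasure) * (∫ x, g x ∂ξ.toMeasure) -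
          (∫ x, f x ∂ξ.toMeasure) * (∫ x, g x) - (∫ x, f x) * (∫ x, g x ∂ξ.toMeasure) +
          (∫ x, f x) * ∫ x, g x) ∂P := by
        refine integral_congr_ae (ae_of_all _ fun ξ => ?_)
        simp only [centredStat]
        ring
    _ = _ := by
        have h1 := hf.mul_const (∫ x, g x)
        have h2 := hg.const_mul (∫ x, f x)
        have h3 : Integrable (fun ξ : Conf => (∫ x, f x ∂ξ.toMeasure) * (∫ x, g x ∂ξ.toMeasure) -
          (∫ x, f x ∂ξ.toMeasure) * (∫ x, g x)) P := hfg.sub h1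
        have h4 : Integrable (fun ξ : Conf => (∫ x, f x ∂ξ.toMeasure) * (∫ x, g x ∂ξ.toMeasure) -
          (∫ x, f x ∂ξ.toMeasure) * (∫ x, g x) - (∫ x, f x) * (∫ x, g x ∂ξ.toMeasure)) P :=
          h3.sub h2
        rw [integral_add h4 (integrable_const _), integral_sub h3 h2,
          integral_sub hfg h1, integral_mul_const, integral_const_mul,
          integral_linStat hP, integral_linStat hP, integral_linStat_mul hP]
        simp

/-! ### Decorrelation of linear statistics at different scales -/

/-- The smooth bump function equal to `1` on `[-1, 1]` and supported in `[-2, 2]`. -/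
noncomputable def unitBump : ContDiffBump (0 : ℝ) := ⟨1, 2, one_pos, one_lt_two⟩

/-- The dilation by `l` of the unit bump. -/
noncomputable def dilatedBump (l : ℝ) (hl : 0 < l) : C_c(ℝ, ℝ) where
  toFun x := unitBump (l⁻¹ * x)
  continuous_toFun := unitBump.continuous.comp (continuous_const.mul continuous_id)
  hasCompactSupport' := unitBump.hasCompactSupport.comp_homeomorph
    (Homeomorph.mulLeft₀ l⁻¹ (inv_pos.2 hl).ne')

lemma dilatedBump_apply {l : ℝ} (hl : 0 < l) (x : ℝ) :
    dilatedBump l hl x = unitBump (l⁻¹ * x) := rfl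

lemma dilatedBump_eq_one {l : ℝ} (hl : 0 < l) {x : ℝ} (hx : |x| ≤ l) :
    dilatedBump l hl x = 1 := by
  refine unitBump.one_of_mem_closedBall ?_
  rw [mem_closedBall_zero_iff, Real.norm_eq_abs, abs_mul, abs_of_pos (inv_pos.2 hl)]
  exact (inv_mul_le_iff₀ hl).2 (by simpa [unitBump] using hx)

/-- The `t`-derivative of the second difference is half a difference of `g'` at points `2t` apart,
so the Lipschitz constant of `g'` serves as `K`. -/
lemma abs_second_difference_le {g : ℝ → ℝ} (hg : ContDiff ℝ 2 g) (hs : HasCompactSupport g) :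
    ∃ K, 0 ≤ K ∧ ∀ x r, |g x - (g (x + r) + g (x - r)) / 2| ≤ K * r ^ 2 := by
  have hg' : ContDiff ℝ 1 (deriv g) := (contDiff_succ_iff_deriv (n := 1)).1 hg |>.2.2
  obtain ⟨K, hK⟩ := hg'.lipschitzWith_of_hasCompactSupport hs.deriv one_ne_zero
  have hd : Differentiable ℝ g := hg.differentiable two_ne_zero
  refine ⟨K, K.2, fun x r => ?_⟩
  have h1 : ∀ t ∈ uIcc 0 r, HasDerivWithinAt (fun t => g x - (g (x + t) + g (x - t)) / 2)
      (-(deriv g (x + t) - deriv g (x - t)) / 2) (uIcc 0 r) t := by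
    intro t _
    have ha := (hd (x + t)).hasDerivAt.comp_const_add x t
    have hb := (hd (x - t)).hasDerivAt.comp_const_sub x t
    refine (((ha.add hb).div_const 2).const_sub (g x)).hasDerivWithinAt.congr_deriv ?_
    ring
  have h2 : ∀ t ∈ uIcc 0 r, ‖-(deriv g (x + t) - deriv g (x - t)) / 2‖ ≤ K * |r| := by
    intro t ht
    have h3 := hK.dist_le_mul (x + t) (x - t)
    rw [Real.dist_eq, Real.dist_eq, show x + t - (x - t) = 2 * t by ring, abs_mul, abs_two] at h3
    have h4 : |t| ≤ |r| := by simpa using abs_sub_left_of_mem_uIcc ht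
    rw [norm_div, norm_neg, Real.norm_eq_abs, Real.norm_eq_abs, abs_two]
    nlinarith [mul_le_mul_of_nonneg_left h4 K.2]
  have := (convex_uIcc 0 r).norm_image_sub_le_of_norm_hasDerivWithin_le h1 h2 left_mem_uIcc
    right_mem_uIcc
  simpa [mul_assoc, ← pow_two] using this

lemma abs_corrDiff_dilatedBump_le :
    ∃ C, 0 ≤ C ∧ ∀ (l : ℝ) (hl : 0 < l) (x : ℝ), |corrDiff (dilatedBump l hl) x| ≤ C / l := by
  obtain ⟨K, hK, h⟩ := abs_second_difference_le unitBump.contDiff unitBump.hasCompactSupport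
  refine ⟨14 * (K + 1) * Real.pi, by positivity, fun l hl x => ?_⟩
  have hi : Integrable fun r : ℝ => 14 * (K + 1) / l ^ 2 * (1 + (l⁻¹ * r) ^ 2)⁻¹ :=
    (integrable_inv_one_add_sq.comp_mul_left' (inv_pos.2 hl).ne').const_mul _
  have hbound : ∀ r, ‖truncCorr r * (dilatedBump l hl x -
      (dilatedBump l hl (x + r) + dilatedBump l hl (x - r)) / 2)‖ ≤
      14 * (K + 1) / l ^ 2 * (1 + (l⁻¹ * r) ^ 2)⁻¹ := by
    intro r
    simp only [dilatedBump_apply, mul_add l⁻¹, mul_sub l⁻¹]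
    set q := |unitBump (l⁻¹ * x) - (unitBump (l⁻¹ * x + l⁻¹ * r) +
      unitBump (l⁻¹ * x - l⁻¹ * r)) / 2| with hq
    have h1 : q ≤ K * (l⁻¹ * r) ^ 2 := h _ _
    have h2 : q ≤ 1 := by
      have b (y : ℝ) : 0 ≤ unitBump y ∧ unitBump y ≤ 1 := ⟨unitBump.nonneg, unitBump.le_one⟩
      have b1 := b (l⁻¹ * x)
      have b2 := b (l⁻¹ * x + l⁻¹ * r)
      have b3 := b (l⁻¹ * x - l⁻¹ * r)
      exact abs_le.2 ⟨by linarith, by linarith⟩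
    -- Adding `q ≤ K u²` and `q u² ≤ u²` for `u = r / l` yields a bound of order `u² / (1 + u²)`.
    -- Its `u²` absorbs the `1 / (1 + r²)` of `truncCorr` at the cost of `1 / l²`, and the remaining
    -- Cauchy profile integrates to `π l`.
    have h3 : q ≤ (K + 1) * (l⁻¹ * r) ^ 2 * (1 + (l⁻¹ * r) ^ 2)⁻¹ := by
      rw [← div_eq_mul_inv, le_div_iff₀ (by positivity)]
      nlinarith [mul_le_mul_of_nonneg_right h2 (sq_nonneg (l⁻¹ * r))]
    rw [norm_mul, Real.norm_eq_abs, Real.norm_eq_abs, ← hq]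
    calc |truncCorr r| * q
        ≤ 14 / (1 + r ^ 2) * ((K + 1) * (l⁻¹ * r) ^ 2 * (1 + (l⁻¹ * r) ^ 2)⁻¹) :=
          mul_le_mul (abs_truncCorr_le r) h3 (abs_nonneg _) (by positivity)
      _ = r ^ 2 / (1 + r ^ 2) * (14 * (K + 1) / l ^ 2 * (1 + (l⁻¹ * r) ^ 2)⁻¹) := by
          field_simp
      _ ≤ 1 * (14 * (K + 1) / l ^ 2 * (1 + (l⁻¹ * r) ^ 2)⁻¹) := by
          gcongr
          exact (div_le_one (by positivity)).2 (by linarith)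
      _ = _ := one_mul _
  refine (norm_integral_le_of_norm_le hi (ae_of_all _ hbound)).trans_eq ?_
  rw [integral_const_mul, Measure.integral_comp_mul_left (fun r : ℝ => (1 + r ^ 2)⁻¹),
    integral_univ_inv_one_add_sq, inv_inv, abs_of_pos hl, smul_eq_mul]
  field_simp

lemma integral_dilatedBump {l : ℝ} (hl : 0 < l) :
    ∫ x, dilatedBump l hl x = l * ∫ x, unitBump x := by
  simp only [dilatedBump_apply]
  rw [Measure.integral_comp_mul_left (fun x => unitBump x), inv_inv, abs_of_pos hl, smul_eq_mul]

/-- The bump of scale `l` is nonnegative with integral proportional to `l`, and `corrDiff` of the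
other is `O(1/m)`. An upper bound suffices for second moments of sums. -/
lemma integral_centredStat_dilatedBump_le :
    ∃ C, 0 ≤ C ∧ ∀ {P : Measure Conf}, IsPfaffianProcess P sineKernelOne →
      ∀ (l m : ℝ) (hl : 0 < l) (hm : 0 < m),
        ∫ ξ, centredStat (dilatedBump l hl) ξ * centredStat (dilatedBump m hm) ξ ∂P ≤
          C * (l / m) := by
  obtain ⟨C, hC, h⟩ := abs_corrDiff_dilatedBump_le
  have hI : 0 ≤ ∫ x, unitBump x := integral_nonneg fun _ => unitBump.nonneg
  refine ⟨C * ∫ x, unitBump x, by positivity, fun hP l m hl hm => ?_⟩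
  rw [integral_centredStat_mul hP]
  calc ∫ x, dilatedBump l hl x * corrDiff (dilatedBump m hm) x
      ≤ ∫ x, dilatedBump l hl x * (C / m) :=
        integral_mono (integrable_mul_corrDiff _ _)
          ((integrable_volume_of_compactSupport _).mul_const _) fun x =>
          mul_le_mul_of_nonneg_left ((le_abs_self _).trans (h m hm x)) unitBump.nonneg
    _ = _ := by
        rw [integral_mul_const, integral_dilatedBump]
        ring

/-- The bumps at the dyadic scales `R`, `2R`, `4R`, … -/
noncomputable def dyadicBump {R : ℝ} (hR : 0 < R) (i : ℕ) : C_c(ℝ, ℝ) :=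
  dilatedBump (R * 2 ^ i) (by positivity)

lemma integral_sum_centredStat_sq_le {R : ℝ} (hR : 0 < R) {P : Measure Conf}
    (hP : IsPfaffianProcess P sineKernelOne) :
    ∃ C, 0 ≤ C ∧ ∀ n : ℕ,
      Integrable (fun ξ => (∑ i ∈ Finset.range n, centredStat (dyadicBump hR i) ξ) ^ 2) P ∧
      ∫ ξ, (∑ i ∈ Finset.range n, centredStat (dyadicBump hR i) ξ) ^ 2 ∂P ≤ C * n := by
  obtain ⟨C, hC, h⟩ := integral_centredStat_dilatedBump_le
  -- Passing from `n` to `n + 1` adds one variance, at most `C`, and twice the covariances with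
  -- smaller scales, whose geometric sum is at most `C`.
  refine ⟨3 * C, by positivity, fun n => ?_⟩
  induction n with
  | zero => simp
  | succ n ih =>
    have hi : ∀ i ∈ Finset.range n, Integrable (fun ξ => centredStat (dyadicBump hR i) ξ *
        centredStat (dyadicBump hR n) ξ) P := fun i _ => integrable_centredStat_mul hP _ _
    have hn : Integrable (fun ξ => centredStat (dyadicBump hR n) ξ *
        centredStat (dyadicBump hR n) ξ) P := integrable_centredStat_mul hP _ _
    have hs := (integrable_finsetSum _ hi).const_mul 2
    have he : (fun ξ => (∑ i ∈ Finset.range (n + 1), centredStat (dyadicBump hR i) ξ) ^ 2) =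
        fun ξ => ((∑ i ∈ Finset.range n, centredStat (dyadicBump hR i) ξ) ^ 2 +
          2 * ∑ i ∈ Finset.range n, centredStat (dyadicBump hR i) ξ *
            centredStat (dyadicBump hR n) ξ) +
          centredStat (dyadicBump hR n) ξ * centredStat (dyadicBump hR n) ξ := by
      funext ξ
      rw [Finset.sum_range_succ, ← Finset.sum_mul]
      ring
    have h12 : Integrable (fun ξ => (∑ i ∈ Finset.range n, centredStat (dyadicBump hR i) ξ) ^ 2 +
          2 * ∑ i ∈ Finset.range n, centredStat (dyadicBump hR i) ξ *
            centredStat (dyadicBump hR n) ξ) P := ih.1.add hs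
    rw [he]
    refine ⟨h12.add hn, ?_⟩
    rw [integral_add h12 hn, integral_add ih.1 hs, integral_const_mul, integral_finsetSum _ hi]
    have h1 : ∑ i ∈ Finset.range n, ∫ ξ, centredStat (dyadicBump hR i) ξ *
        centredStat (dyadicBump hR n) ξ ∂P ≤ C := by
      calc _ ≤ ∑ i ∈ Finset.range n, C * (2 ^ i / 2 ^ n) := by
            refine Finset.sum_le_sum fun i _ => (h hP _ _ _ _).trans_eq ?_
            rw [mul_div_mul_left _ _ hR.ne']
        _ = C * ((2 ^ n - 1) / 2 ^ n) := by
            rw [← Finset.mul_sum, ← Finset.sum_div, geom_sum_eq (by norm_num)]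
            norm_num
        _ ≤ C * 1 := by
            gcongr
            rw [div_le_one (by positivity)]
            linarith
        _ = C := mul_one C
    have h2 : ∫ ξ, centredStat (dyadicBump hR n) ξ * centredStat (dyadicBump hR n) ξ ∂P ≤ C := by
      refine (h hP _ _ _ _).trans_eq ?_
      rw [div_self (by positivity), mul_one]
    push_cast
    linarith [ih.2]

/-! ### Rigidity -/

lemma measurable_linStat (f : C_c(ℝ, ℝ)) : Measurable fun ξ : Conf => ∫ x, f x ∂ξ.toMeasure := by
  let F : C_c(ℝ, ℂ) :=
    { toFun := fun x => (f x : ℂ)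
      continuous_toFun := by fun_prop
      hasCompactSupport' := f.hasCompactSupport.comp_left Complex.ofReal_zero }
  have hF : Continuous fun ξ : Conf => ∫ x, F x ∂ξ.toMeasure :=
    continuous_iInf_dom (i := F) continuous_induced_dom
  have he : (fun ξ : Conf => ∫ x, f x ∂ξ.toMeasure) = fun ξ => (∫ x, F x ∂ξ.toMeasure).re := by
    funext ξ
    rw [show (fun x => F x) = fun x => ((f x : ℝ) : ℂ) from rfl, integral_complex_ofReal,
      Complex.ofReal_re]
  rw [he]
  exact (Complex.continuous_re.comp hF).measurable

lemma measurable_centredStat (f : C_c(ℝ, ℝ)) : Measurable (centredStat f) :=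
  (measurable_linStat f).sub_const _

lemma centredStat_restrict_compl (f : C_c(ℝ, ℝ)) {B : Set ℝ} (hB : MeasurableSet B)
    (h : ∀ x ∈ B, f x = 1) (ξ : Conf) :
    centredStat f (ξ.restrict Bᶜ hB.compl) = centredStat f ξ - ξ.toMeasure.real B := by
  have := ξ.locallyFinite
  have hf : Integrable f ξ.toMeasure :=
    f.continuous.integrable_of_hasCompactSupport f.hasCompactSupport
  have h1 : ∫ x in B, f x ∂ξ.toMeasure = ξ.toMeasure.real B := by
    rw [setIntegral_congr_fun hB h]
    simp
  have h2 : ∫ x in B, f x ∂ξ.toMeasure + ∫ x in Bᶜ, f x ∂ξ.toMeasure = ∫ x, f x ∂ξ.toMeasure :=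
    integral_add_compl hB hf
  have h3 : centredStat f (ξ.restrict Bᶜ hB.compl) =
    ∫ x in Bᶜ, f x ∂ξ.toMeasure - ∫ x, f x := rfl
  rw [h3, centredStat]
  linarith

lemma Conf.exists_nat_real_eq (ξ : Conf) {B : Set ℝ} (hB : MeasurableSet B) :
    ∃ n : ℕ, ξ.toMeasure.real B = n := by
  obtain ⟨n, hn⟩ := ξ.integerValued B hB
  refine ⟨n.toNat, ?_⟩
  rw [Measure.real, hn]
  cases n <;> simp

/-- The mean squares are at most `C / n`, so the squares tend to `0` in `L¹`, hence in measure,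
hence almost surely along a subsequence. -/
lemma exists_seq_centredStat_tendsto_zero {R : ℝ} (hR : 0 < R) {P : Measure Conf}
    (hP : IsPfaffianProcess P sineKernelOne) :
    ∃ ns : ℕ → ℕ, StrictMono ns ∧ ∀ᵐ ξ ∂P, Tendsto (fun k =>
      (∑ i ∈ Finset.range (ns k), centredStat (dyadicBump hR i) ξ) / ns k) atTop (𝓝 0) := by
  obtain ⟨C, hC, h⟩ := integral_sum_centredStat_sq_le hR hP
  set A : ℕ → Conf → ℝ := fun n ξ => ∑ i ∈ Finset.range n, centredStat (dyadicBump hR i) ξ with hA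
  have hi : ∀ n, Integrable (fun ξ => (A n ξ / n) ^ 2) P := fun n => by
    simpa only [div_pow] using (h n).1.div_const ((n : ℝ) ^ 2)
  have hb : ∀ n : ℕ, ∫ ξ, (A n ξ / n) ^ 2 ∂P ≤ C / n := by
    intro n
    simp_rw [div_pow]
    rw [integral_div]
    rcases Nat.eq_zero_or_pos n with rfl | hn
    · simp
    · have hn : (0 : ℝ) < n := by exact_mod_cast hn
      rw [div_le_div_iff₀ (by positivity) hn]
      nlinarith [mul_le_mul_of_nonneg_right (h n).2 hn.le]
  have ht : TendstoInMeasure P (fun n ξ => (A n ξ / n) ^ 2) atTop 0 := by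
    refine tendstoInMeasure_of_tendsto_eLpNorm one_ne_zero (fun n => (hi n).1)
      aestronglyMeasurable_zero ?_
    have he : ∀ n, eLpNorm ((fun ξ => (A n ξ / n) ^ 2) - 0) 1 P =
        ENNReal.ofReal (∫ ξ, (A n ξ / n) ^ 2 ∂P) := by
      intro n
      rw [sub_zero, eLpNorm_one_eq_lintegral_enorm, ← ofReal_integral_norm_eq_lintegral_enorm (hi n)]
      simp only [norm_pow, Real.norm_eq_abs, sq_abs]
    simp_rw [he]
    refine tendsto_of_tendsto_of_tendsto_of_le_of_le tendsto_const_nhds ?_ (fun _ => zero_le)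
      fun n => ENNReal.ofReal_le_ofReal (hb n)
    rw [← ENNReal.ofReal_zero]
    exact ENNReal.tendsto_ofReal (tendsto_const_div_atTop_nhds_zero_nat C)
  obtain ⟨ns, hns, hae⟩ := ht.exists_seq_tendsto_ae
  refine ⟨ns, hns, hae.mono fun ξ hξ => ?_⟩
  have h1 : Tendsto (fun k => (A (ns k) ξ / ns k) ^ 2) atTop (𝓝 0) := hξ
  have h2 := h1.sqrt
  simp only [Real.sqrt_sq_eq_abs, Real.sqrt_zero] at h2
  exact (tendsto_zero_iff_abs_tendsto_zero _).2 h2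

end PfaffianPP

open PfaffianPP MeasureTheory Filter Topology in
theorem proposition1p5 (P : MeasureTheory.Measure PfaffianPP.Conf)
    (hP : PfaffianPP.IsPfaffianProcess P PfaffianPP.sineKernelOne) :
    PfaffianPP.NumberRigid P := by
  intro B hB hbdd
  obtain ⟨R, hR, hBR⟩ := hbdd.exists_pos_norm_le
  obtain ⟨ns, hns, hae⟩ := exists_seq_centredStat_tendsto_zero hR hP
  -- The sign is reversed because deleting the points in `B` lowers each centred statistic by
  -- `ξ(B)`.
  set L : ℕ → Conf → ℝ := fun k ξ =>
    -((∑ i ∈ Finset.range (ns k), centredStat (dyadicBump hR i) ξ) / ns k) with hL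
  have hLm : ∀ k, Measurable (L k) := fun k =>
    ((Finset.measurable_sum _ fun i _ => measurable_centredStat _).div_const _).neg
  -- The `EReal` limsup is defined and measurable on all configurations, convergent or not; the
  -- floor after adding `1/2` makes the value an integer and fixes integers.
  refine ⟨fun ξ => ⌊(limsup (fun k => (L k ξ : EReal)) atTop).toReal + 1 / 2⌋,
    Int.measurable_floor.comp
      ((Measurable.limsup fun k => (hLm k).coe_real_ereal).ereal_toReal.add_const _), ?_⟩
  filter_upwards [hae] with ξ hξ
  have hone : ∀ i, ∀ x ∈ B, dyadicBump hR i x = 1 := fun i x hx =>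
    dilatedBump_eq_one _ ((hBR x hx).trans (le_mul_of_one_le_right hR.le
      (one_le_pow₀ one_le_two)))
  have hlim : Tendsto (fun k => L k (ξ.restrict Bᶜ hB.compl)) atTop (𝓝 (ξ.toMeasure.real B)) := by
    have h0 : Tendsto (fun k => L k ξ + ξ.toMeasure.real B) atTop (𝓝 (ξ.toMeasure.real B)) := by
      simpa using hξ.neg.add_const (ξ.toMeasure.real B)
    refine h0.congr' ?_
    -- The mean of `ns k` copies of `ξ(B)` is `ξ(B)` only when `ns k ≠ 0`.
    filter_upwards [hns.tendsto_atTop.eventually_gt_atTop 0] with k hk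
    have hk : (ns k : ℝ) ≠ 0 := by exact_mod_cast hk.ne'
    simp only [hL, centredStat_restrict_compl _ hB (hone _), Finset.sum_sub_distrib,
      Finset.sum_const, Finset.card_range, nsmul_eq_mul]
    field_simp
    ring
  have hE : limsup (fun k => (L k (ξ.restrict Bᶜ hB.compl) : EReal)) atTop =
      (ξ.toMeasure.real B : EReal) :=
    ((continuous_coe_real_ereal.tendsto _).comp hlim).limsup_eq
  obtain ⟨n, hn⟩ := ξ.exists_nat_real_eq hB
  rw [hE, EReal.toReal_coe, hn, Int.floor_natCast_add]
  norm_num
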